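/- Let $d\ge 1$, and let $n_1,\dots,n_d\ge 2$ and $r_1,\dots,r_d\ge 2$ be integers with $n_1r_1\le n_2r_2\le\cdots\le n_dr_d$. Put $n=\prod_i n_i$, $r=\prod_i r_i$, $N_i=\prod_{j=d-i+1}^d n_j$, $R_i=\prod_{j=d-i+1}^d r_j$, and assume $n\ge r$. Let $P$ be an integer with $1\le P\le nr$. The Multi-TTM of an $n_1\times\cdots\times n_d$ tensor $X$ with matrices $A^{(k)}$ of size $n_k\times r_k$ is the $r_1\times\cdots\times r_d$ tensor $$Y(j)=\sum_{i} X(i)\prod_{k=1}^d A^{(k)}(i_k,j_k).$$ *Lower bound.* Put $$\mathrm{O}=\frac{n+r+\sum_{k} n_kr_k}{P},\qquad B=\begin{cases} r+\frac nP & \text{if } P<\frac nr,\\ 2\left(\frac{nr}{P}\right)^{1/2} & \text{if } \frac nr\le P,\end{cases}\qquad A=\sum_{j=1}^{d-I}n_jr_j+I\left(\frac{N_IR_I}{P}\right)^{1/I},$$ where, with $T_i=N_iR_i/(n_{d-i}r_{d-i})^i$ for $1\le i\le d-1$, the index $I\in\{1,\dots,d\}$ is determined by $T_{I-1}\le P$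 (if $I\ge 2$) and $P<T_I$ (if $I\le d-1$). Let $\mathrm{LB}=A+B-\mathrm{O}$. *Algorithms.* In a parallel atomic Multi-TTM algorithm on $P$ processors, each of the $nr$ terms $X(i)\prod_k A^{(k)}(i_k,j_k)$ is computed as a whole on one processor, which then must hold its $d+1$ factors; processors may add partial sums of the same entry of $Y$ that they hold, and send entries of the inputs or partial sums of entries of $Y$ that they hold to each other. Each input entry is initially owned by exactly one processor, and each entry of $Y$ is in the end owned by exactly one processor. The algorithm is load balanced if each processor computes exactly $nr/P$ terms. *The grid algorithm.* Arrange $P=pq$ processors, $p=\prod_k p_k$, $q=\prod_k q_k$, in a $p_1\times\cdots\times p_d\times q_1\times\cdots\times q_d$ grid, where $p_k\mid n_k$ and $q_k\mid r_k$, and cut the $k$-th index range of $X$ into $p_k$ and that of $Y$ into $q_k$ equal consecutive blocks. Processor $(p'_1,\dots,p'_d,q'_1,\dots,q'_d)$ obtains the subtensor $X_{p'_1\cdots p'_d}$ by an All-Gather over the processors $(p'_1,\dots,p'_d,*,\dots,*)$; for each $k$ it obtains the submatrix $A^{(k)}_{p'_kq'_k}$ by an All-Gather over the processors with the same $p'_k$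 and $q'_k$; it computes the Multi-TTM of these data; and the results are summed into $Y_{q'_1\cdots q'_d}$ by a Reduce-Scatter over the processors $(*,\dots,*,q'_1,\dots,q'_d)$. Either collective on $Q$ processors has bandwidth cost $(1-\frac1Q)w$, where $w$ is the number of words on each processor after the All-Gather or before the Reduce-Scatter; the bandwidth cost of the algorithm is the sum of the costs of its $d+2$ collectives. For real $p_k,q_k\ge 1$ with $pq=P$ define, accordingly, $$C(p_1,\dots,p_d,q_1,\dots,q_d)=\Big(1-\frac pP\Big)\frac np+\sum_{k=1}^d\Big(1-\frac{p_kq_k}{P}\Big)\frac{n_kr_k}{p_kq_k}+\Big(1-\frac qP\Big)\frac rq .$$ **Theorem.** 1. In every load balanced parallel atomic Multi-TTM algorithm on $P$ processors some processor sends or receives at least $\mathrm{LB}$ words in total. 2. For all positive integers $p_k\mid n_k$, $q_k\mid r_k$ with $pq=P$, the grid algorithm computes $Y$, computes each term on exactly one processor, computes $nr/P$ terms on each processor, and has bandwidth cost $C(p_1,\dots,p_d,q_1,\dots,q_d)$. 3. There exist real numbers $1\le p_k\le n_k$ and $1\le q_k\le r_k$ $(1\le k\le d)$ with $pq=P$ such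 that $$C(p_1,\dots,p_d,q_1,\dots,q_d)=\frac np+\frac rq+\sum_{k=1}^d\frac{n_kr_k}{p_kq_k}-\mathrm{O}\ \le\ 3\,\mathrm{LB}.$$ Thus, integrality of the grid aside, the grid algorithm is communication optimal up to a factor of $3$. -/

import Mathlib

namespace MultiTTM

/-! Throughout, a mode is an element of `Fin d`; the modes `1, …, d` of the text are
`0, …, d - 1` here. `n k` and `r k` are the sizes of the input and output tensor in mode `k`. -/

/-- Index of an entry of a tensor of size `n 0 × ⋯ × n (d - 1)`. -/
abbrev Idx {d : ℕ} (n : Fin d → ℕ) : Type := ∀ k : Fin d, Fin (n k)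

/-- The Multi-TTM `X ×₁ A₁ᵀ ⋯ ×_d A_dᵀ`. -/
noncomputable def multiTTM {d : ℕ} {n r : Fin d → ℕ} (X : Idx n → ℝ)
    (A : ∀ k : Fin d, Matrix (Fin (n k)) (Fin (r k)) ℝ) : Idx r → ℝ :=
  fun j => ∑ i : Idx n, X i * ∏ k, A k (i k) (j k)

/-! ### Parallel atomic algorithms -/

/-- The words that processors can hold and communicate: the entries of the input tensor, the
entries of the input matrices, and partial sums of entries of the output tensor. `part j S` is the
value `∑ i ∈ S, X i * ∏ k, A k (i k) (j k)`. -/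
inductive Word {d : ℕ} (n r : Fin d → ℕ) : Type
  | x (i : Idx n) : Word n r
  | a (k : Fin d) (i : Fin (n k)) (j : Fin (r k)) : Word n r
  | part (j : Idx r) (S : Finset (Idx n)) : Word n r

/-- One word sent by the processor `src` and received by the processor `dst`. -/
structure Message {d : ℕ} (n r : Fin d → ℕ) (P : ℕ) where
  src : Fin P
  dst : Fin P
  word : Word n r

/-- What is fixed before the run of an atomic Multi-TTM algorithm on `P` processors: the
processor that owns each entry (exactly one copy of each input entry at the start and of each output
entry at the end), and, for each of the terms `X i * ∏ k, A k (i k) (j k)`, the one processor on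
which it is computed. -/
structure Layout {d : ℕ} (n r : Fin d → ℕ) (P : ℕ) where
  ownerX : Idx n → Fin P
  ownerA : ∀ k : Fin d, Fin (n k) → Fin (r k) → Fin P
  ownerY : Idx r → Fin P
  proc : Idx n → Idx r → Fin P

namespace Layout

variable {d : ℕ} {n r : Fin d → ℕ} {P : ℕ}

/-- The words that processor `s` holds at the start. -/
def initial (L : Layout n r P) (s : Fin P) : Set (Word n r) :=
  {w | (∃ i, L.ownerX i = s ∧ w = .x i) ∨ (∃ k i j, L.ownerA k i j = s ∧ w = .a k i j)}

/-- `L.Run T M`: the processors can reach the state in which each processor `s` has held the words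
`M s`, the messages exchanged so far being `T` (latest first). A step is the atomic computation of
one term on its processor, a local addition of two partial sums, or a message. -/
inductive Run (L : Layout n r P) : List (Message n r P) → (Fin P → Set (Word n r)) → Prop
  | start : Run L [] L.initial
  | compute {T M} (i : Idx n) (j : Idx r) (h : Run L T M)
      (hx : Word.x i ∈ M (L.proc i j))
      (ha : ∀ k, Word.a k (i k) (j k) ∈ M (L.proc i j)) :
      Run L T (Function.update M (L.proc i j) (insert (Word.part j {i}) (M (L.proc i j))))
  | add {T M} (s : Fin P) (j : Idx r) (S₁ S₂ : Finset (Idx n)) (h : Run L T M)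
      (h₁ : Word.part j S₁ ∈ M s) (h₂ : Word.part j S₂ ∈ M s) (hS : Disjoint S₁ S₂) :
      Run L T (Function.update M s (insert (Word.part j (S₁.disjUnion S₂ hS)) (M s)))
  | send {T M} (src dst : Fin P) (w : Word n r) (h : Run L T M) (hne : src ≠ dst)
      (hw : w ∈ M src) :
      Run L (⟨src, dst, w⟩ :: T) (Function.update M dst (insert w (M dst)))

/-- The messages `T` are those of a complete run: at its end every output entry is held by its
owner. -/
def Computes (L : Layout n r P) (T : List (Message n r P)) : Prop :=
  ∃ M, L.Run T M ∧ ∀ j, Word.part j Finset.univ ∈ M (L.ownerY j)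

/-- Every processor computes exactly `1 / P` of the terms. -/
def LoadBalanced (L : Layout n r P) : Prop :=
  ∀ s : Fin P, (Finset.univ.filter fun t : Idx n × Idx r => L.proc t.1 t.2 = s).card * P =
    (∏ k, n k) * ∏ k, r k

end Layout

/-- The number of words that processor `s` sends or receives. -/
def traffic {d : ℕ} {n r : Fin d → ℕ} {P : ℕ} (T : List (Message n r P)) (s : Fin P) : ℕ :=
  T.countP fun m => decide (m.src = s ∨ m.dst = s)

/-! ### The lower bound -/

section LowerBound

variable {d : ℕ} (n r : Fin d → ℕ) (P : ℕ)

/-- Product of the `i` rightmost terms (`N_i` for `n`, `R_i` for `r`). -/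
def tailProd (m : Fin d → ℕ) (i : ℕ) : ℕ := ∏ j : Fin d with d - i ≤ j.val, m j

/-- The threshold `N_i R_i / (n_{d-i} r_{d-i}) ^ i` for `1 ≤ i ≤ d - 1` (`Fin.rev i` is the mode
`d - i` when modes are numbered from one). -/
noncomputable def threshold (i : Fin d) : ℝ :=
  ((tailProd n i : ℝ) * tailProd r i) / ((n i.rev : ℝ) * r i.rev) ^ (i : ℕ)

/-- The case of the matrix term: the first `i` in `1, …, d` such that `i = d` or
`P < threshold i`. -/
noncomputable def caseIndex : ℕ :=
  sInf {i : ℕ | 1 ≤ i ∧ ∀ h : i < d, (P : ℝ) < threshold n r ⟨i, h⟩}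

/-- The case index `i` is characterized by `1 ≤ i ≤ d`, `threshold (i - 1) ≤ P` (if `2 ≤ i`), and
`P < threshold i` (if `i < d`). -/
theorem caseIndex_spec (hd : 1 ≤ d) :
    (1 ≤ caseIndex n r P ∧ caseIndex n r P ≤ d) ∧
    (∀ h : caseIndex n r P - 1 < d, 2 ≤ caseIndex n r P →
      threshold n r ⟨caseIndex n r P - 1, h⟩ ≤ P) ∧
    (∀ h : caseIndex n r P < d, (P : ℝ) < threshold n r ⟨caseIndex n r P, h⟩) := by
  have hmem : d ∈ {i : ℕ | 1 ≤ i ∧ ∀ h : i < d, (P : ℝ) < threshold n r ⟨i, h⟩} :=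
    ⟨hd, fun h => absurd h (lt_irrefl d)⟩
  have hs := Nat.sInf_mem ⟨d, hmem⟩
  refine ⟨⟨hs.1, Nat.sInf_le hmem⟩, fun h h2 => ?_, hs.2⟩
  by_contra hlt
  have h3 : caseIndex n r P ≤ caseIndex n r P - 1 :=
    Nat.sInf_le ⟨by omega, fun _ => not_le.mp hlt⟩
  omega

/-- The matrix term `A`. -/
noncomputable def matrixTerm : ℝ :=
  (∑ j : Fin d with j.val < d - caseIndex n r P, (n j : ℝ) * r j) +
    caseIndex n r P *
      (((tailProd n (caseIndex n r P) : ℝ) * tailProd r (caseIndex n r P)) / P) ^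
        (1 / (caseIndex n r P : ℝ))

/-- The tensor term `B`. -/
noncomputable def tensorTerm : ℝ :=
  if (P : ℝ) < (∏ k, (n k : ℝ)) / ∏ k, (r k : ℝ) then
    ∏ k, (r k : ℝ) + (∏ k, (n k : ℝ)) / P
  else 2 * (((∏ k, (n k : ℝ)) * ∏ k, (r k : ℝ)) / P) ^ (1 / 2 : ℝ)

/-- The average amount `O` of data owned by a processor. -/
noncomputable def owned : ℝ :=
  (∏ k, (n k : ℝ) + ∏ k, (r k : ℝ) + ∑ k, (n k : ℝ) * r k) / P

/-- The lower bound `A + B - O`. -/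
noncomputable def lowerBound : ℝ := matrixTerm n r P + tensorTerm n r P - owned n r P

end LowerBound

/-! ### The algorithm on a `2d`-dimensional processor grid -/

/-- Bandwidth cost of a bandwidth-optimal All-Gather or Reduce-Scatter on `Q` processors, where `w`
is the number of words on each processor after the All-Gather or before the Reduce-Scatter. -/
noncomputable def collectiveCost (Q w : ℝ) : ℝ := (1 - 1 / Q) * w

/-- The `c`-th of `b` consecutive blocks of equal length of the indices `0, …, m - 1`. -/
def block (m b : ℕ) (c : Fin b) : Finset (Fin m) :=
  Finset.univ.filter fun i => c.val * (m / b) ≤ i.val ∧ i.val < (c.val + 1) * (m / b)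

/-- A processor `(p'_1, …, p'_d, q'_1, …, q'_d)` of the grid. -/
abbrev GridProc {d : ℕ} (p q : Fin d → ℕ) : Type := Idx p × Idx q

section Grid

variable {d : ℕ} (n r : Fin d → ℕ) {p q : Fin d → ℕ}

/-- Indices of the subtensor of the input that processor `s` gathers. -/
def blockX (s : GridProc p q) : Finset (Idx n) :=
  Fintype.piFinset fun k => block (n k) (p k) (s.1 k)

/-- Indices of the submatrix of the `k`-th matrix that processor `s` gathers. -/
def blockA (k : Fin d) (s : GridProc p q) : Finset (Fin (n k) × Fin (r k)) :=
  block (n k) (p k) (s.1 k) ×ˢ block (r k) (q k) (s.2 k)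

/-- Indices of the subtensor of the output to which processor `s` contributes. -/
def blockY (s : GridProc p q) : Finset (Idx r) :=
  Fintype.piFinset fun k => block (r k) (q k) (s.2 k)

/-- The processors `(p'_1, …, p'_d, *, …, *)`. -/
def groupX (s : GridProc p q) : Finset (GridProc p q) :=
  Finset.univ.filter fun t => t.1 = s.1

/-- The processors `(*, …, *, p'_k, *, …, *, q'_k, *, …, *)`. -/
def groupA (k : Fin d) (s : GridProc p q) : Finset (GridProc p q) :=
  Finset.univ.filter fun t => t.1 k = s.1 k ∧ t.2 k = s.2 k

/-- The processors `(*, …, *, q'_1, …, q'_d)`. -/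
def groupY (s : GridProc p q) : Finset (GridProc p q) :=
  Finset.univ.filter fun t => t.2 = s.2

/-- Bandwidth cost of a line of the algorithm, in which each processor `s` takes part in one
collective, over the processors `group s`, with `words s` words. -/
noncomputable def lineCost (group : GridProc p q → Finset (GridProc p q))
    (words : GridProc p q → ℕ) : ℝ :=
  ⨆ s, collectiveCost (group s).card (words s)

variable (p q) in
/-- Bandwidth cost of the algorithm: All-Gather of the input tensor, All-Gather of each matrix, and
Reduce-Scatter of the output tensor. -/
noncomputable def gridAlgorithmCost : ℝ :=
  lineCost (p := p) (q := q) groupX (fun s => (blockX n s).card) +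
    ∑ k, lineCost (p := p) (q := q) (groupA k) (fun s => (blockA n r k s).card) +
    lineCost (p := p) (q := q) groupY (fun s => (blockY r s).card)

variable {n r}

/-- The temporary tensor that processor `s` computes from the gathered data; the algorithm uses its
entries at `j ∈ blockY r s` only. -/
noncomputable def localMultiTTM (X : Idx n → ℝ)
    (A : ∀ k : Fin d, Matrix (Fin (n k)) (Fin (r k)) ℝ) (s : GridProc p q) (j : Idx r) : ℝ :=
  ∑ i ∈ blockX n s, X i * ∏ k, A k (i k) (j k)

/-- The result of the Reduce-Scatter over the group of processor `s`, at `j ∈ blockY r s`. -/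
noncomputable def gridAlgorithmOutput (X : Idx n → ℝ)
    (A : ∀ k : Fin d, Matrix (Fin (n k)) (Fin (r k)) ℝ) (s : GridProc p q) (j : Idx r) : ℝ :=
  ∑ t ∈ groupY s, localMultiTTM X A t j

end Grid

/-- The cost of the algorithm as a function of real grid dimensions: the sum of the costs of its
collectives, over `P / p`, `P / (p_k q_k)` and `P / q` processors. -/
noncomputable def gridCost {d : ℕ} (n r : Fin d → ℕ) (P : ℕ) (p q : Fin d → ℝ) : ℝ :=
  collectiveCost (P / ∏ k, p k) ((∏ k, (n k : ℝ)) / ∏ k, p k) +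
    ∑ k, collectiveCost (P / (p k * q k)) ((n k : ℝ) * r k / (p k * q k)) +
    collectiveCost (P / ∏ k, q k) ((∏ k, (r k : ℝ)) / ∏ k, q k)

end MultiTTM

namespace MultiTTM

/-! ### Real inequalities and choices in boxes -/

/-! Write F = nr/P. If the F terms of a processor involve x entries of X, y of Y and a_k of the k-th
matrix, then F ≤ xy and F ≤ ∏ a_k, because a term is determined by its pair (i, j) and also by its d
pairs (i_k, j_k). The minimum of x + y under F ≤ xy, y ≤ r is B (`tensorTerm_le_add`); the minimum
of ∑ a_k under F ≤ ∏ a_k, a_k ≤ n_k r_k is A (`matrixTerm_le_sum`). Some processor owns at most the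
average O of the entries, and each entry that it uses but does not own occurs in one of its messages
(`Layout.Computes.owner_eq_or_touches`). Its traffic is therefore at least A + B - O.

For the grid, let u_k = n_k/p_k and v_k = r_k/q_k be the block sizes. The cost is ∏ u_k + ∏ v_k + ∑
u_k v_k - O, so it would equal LB if ∏ u_k = x, ∏ v_k = y and u_k v_k = c_k for the optima (x, y)
and c of the two problems, whose products are both F. The box constraints 1 ≤ u_k ≤ n_k, 1 ≤ v_k ≤
r_k can exclude this. It is still possible to attain x and y exactly while ∑ u_k v_k exceeds ∑ c_k
by at most y - 1 (`exists_factorization_eq`, `exists_factorization_le`). Since LB ≥ y(1 - 1/P) ≥ y/2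
for P ≥ 2 (`sub_one_mul_le_lowerBound`), the cost is at most LB + (y - 1) ≤ 3 LB. -/

theorem sum_sub_one_le_prod_sub_one {ι : Type*} (s : Finset ι) (v : ι → ℝ)
    (hv : ∀ k ∈ s, 1 ≤ v k) : ∑ k ∈ s, (v k - 1) ≤ ∏ k ∈ s, v k - 1 := by
  classical
  induction s using Finset.induction_on with
  | empty => simp
  | insert a s ha ih =>
    rw [Finset.sum_insert ha, Finset.prod_insert ha]
    have h1 := ih fun k hk => hv k (Finset.mem_insert_of_mem hk)
    have h2 : 1 ≤ v a := hv a (Finset.mem_insert_self a s)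
    have h3 : 0 ≤ ∑ k ∈ s, (v k - 1) :=
      Finset.sum_nonneg fun k hk => sub_nonneg.2 (hv k (Finset.mem_insert_of_mem hk))
    nlinarith

/-- A box contains a point with any prescribed product between the extreme ones. -/
theorem exists_prod_eq_of_mem_box {ι : Type*} [Fintype ι] {lo hi : ι → ℝ} (h : ∀ k, lo k ≤ hi k)
    {y : ℝ} (hlo : ∏ k, lo k ≤ y) (hhi : y ≤ ∏ k, hi k) :
    ∃ v : ι → ℝ, (∀ k, lo k ≤ v k ∧ v k ≤ hi k) ∧ ∏ k, v k = y := by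
  have hc : ContinuousOn (fun τ : ℝ => ∏ k, (lo k + τ * (hi k - lo k))) (Set.Icc 0 1) := by
    fun_prop
  obtain ⟨τ, hτ, hy⟩ := intermediate_value_Icc zero_le_one hc (show y ∈ _ by simpa using ⟨hlo, hhi⟩)
  refine ⟨_, fun k => ?_, hy⟩
  have := h k
  constructor <;> nlinarith [hτ.1, hτ.2]

/-- Optimality of the point `c` for the sum under a lower bound on the product, when the
coordinates `a k` with `c k < t` are bounded by `c k`. -/
theorem sum_le_sum_of_prod_le_prod {ι : Type*} [Fintype ι] {a c : ι → ℝ} {t : ℝ}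
    (ht : 0 < t) (ha : ∀ k, 0 < a k) (hc : ∀ k, 0 < c k)
    (h : ∀ k, c k = t ∨ (c k ≤ t ∧ a k ≤ c k)) (hprod : ∏ k, c k ≤ ∏ k, a k) :
    ∑ k, c k ≤ ∑ k, a k := by
  -- Lagrange certificate with multiplier t for the constraint on ∑ log a_k. The tangent bound c
  -- log(a/c) ≤ a - c settles c = t; if c ≤ t and a ≤ c, the logarithm is nonpositive and replacing
  -- c by t only lowers the left side.
  have h1 : ∀ k, c k + t * (Real.log (a k) - Real.log (c k)) ≤ a k := by
    intro k
    rw [← Real.log_div (ha k).ne' (hc k).ne']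
    have h2 : c k * Real.log (a k / c k) ≤ a k - c k := by
      have := mul_le_mul_of_nonneg_left (Real.log_le_sub_one_of_pos (div_pos (ha k) (hc k)))
        (hc k).le
      rwa [mul_sub, mul_div_cancel₀ _ (hc k).ne', mul_one] at this
    rcases h k with h3 | ⟨h3, h4⟩
    · rw [← h3]; linarith
    · have h5 : Real.log (a k / c k) ≤ 0 :=
        Real.log_nonpos (div_pos (ha k) (hc k)).le ((div_le_one (hc k)).2 h4)
      nlinarith
  have h2 : ∑ k, Real.log (c k) ≤ ∑ k, Real.log (a k) := by
    rw [← Real.log_prod fun k _ => (ha k).ne', ← Real.log_prod fun k _ => (hc k).ne']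
    exact Real.log_le_log (Finset.prod_pos fun k _ => hc k) hprod
  calc ∑ k, c k ≤ ∑ k, (c k + t * (Real.log (a k) - Real.log (c k))) := by
        rw [Finset.sum_add_distrib, ← Finset.mul_sum, Finset.sum_sub_distrib]
        nlinarith
    _ ≤ _ := Finset.sum_le_sum fun k _ => h1 k

/-! ### Splitting the matrix optimum over the two tensors -/

section Factorization

variable {ι : Type*} [Fintype ι] {N R c : ι → ℝ} {x y : ℝ}

/-- With v = c/u, all constraints together say that u lies in the box from c / min(R, c) to min(N,
c). The hypotheses on y and x say that x lies between the two extreme products of this box. -/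
theorem exists_factorization_eq (hR : ∀ k, 1 ≤ R k) (hN : ∀ k, 1 ≤ N k)
    (hc1 : ∀ k, 1 ≤ c k) (hcm : ∀ k, c k ≤ N k * R k)
    (hprod : ∏ k, c k = x * y) (hx : 1 ≤ x)
    (hyc : y ≤ ∏ k, min (R k) (c k)) (hxc : x ≤ ∏ k, min (N k) (c k)) :
    ∃ u v : ι → ℝ, (∀ k, 1 ≤ u k ∧ u k ≤ N k) ∧ (∀ k, 1 ≤ v k ∧ v k ≤ R k) ∧
      ∏ k, u k = x ∧ ∏ k, v k = y ∧ ∀ k, u k * v k = c k := by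
  have hpos : ∀ k, 0 < min (R k) (c k) := fun k =>
    lt_min (by linarith [hR k]) (by linarith [hc1 k])
  have hbox : ∀ k, c k / min (R k) (c k) ≤ min (N k) (c k) := by
    intro k
    rw [div_le_iff₀ (hpos k)]
    rcases min_choice (R k) (c k) with h | h <;> rcases min_choice (N k) (c k) with h' | h' <;>
      rw [h, h'] <;> nlinarith [hR k, hN k, hc1 k, hcm k]
  have hlo : ∏ k, c k / min (R k) (c k) ≤ x := by
    rw [Finset.prod_div_distrib, div_le_iff₀ (Finset.prod_pos fun k _ => hpos k), hprod]
    exact mul_le_mul_of_nonneg_left hyc (by linarith)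
  obtain ⟨u, hu, hux⟩ := exists_prod_eq_of_mem_box hbox hlo hxc
  have hu1 : ∀ k, 1 ≤ u k := fun k =>
    le_trans ((one_le_div (hpos k)).2 (min_le_right _ _)) (hu k).1
  refine ⟨u, fun k => c k / u k, fun k => ⟨hu1 k, (hu k).2.trans (min_le_left _ _)⟩,
    fun k => ⟨?_, ?_⟩, hux, ?_, fun k => ?_⟩
  · rw [one_le_div (by linarith [hu1 k])]
    exact (hu k).2.trans (min_le_right _ _)
  · have h1 := (hu k).1
    rw [div_le_iff₀ (hpos k)] at h1
    rw [div_le_iff₀ (by linarith [hu1 k])]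
    nlinarith [hu1 k, min_le_left (R k) (c k)]
  · rw [Finset.prod_div_distrib, hux, hprod, mul_div_cancel_left₀ _ (by linarith)]
  · exact mul_div_cancel₀ _ (by linarith [hu1 k])

/-- Here y may be too large for an exact splitting, so v is raised above min(R, c). Modes with R ≤ c
lose nothing, since v = R and uR ≤ c; modes with c ≤ R have u = 1 and lose v - c ≤ v - 1. These
losses add up to at most ∏ v - 1. -/
theorem exists_factorization_le (hR : ∀ k, 1 ≤ R k) (hN : ∀ k, 1 ≤ N k)
    (hc1 : ∀ k, 1 ≤ c k) (hcm : ∀ k, c k ≤ N k * R k)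
    (hprod : ∏ k, c k = x * y) (hx : 1 ≤ x)
    (hyc : ∏ k, min (R k) (c k) ≤ y) (hyR : y ≤ ∏ k, R k) :
    ∃ u v : ι → ℝ, (∀ k, 1 ≤ u k ∧ u k ≤ N k) ∧ (∀ k, 1 ≤ v k ∧ v k ≤ R k) ∧
      ∏ k, u k = x ∧ ∏ k, v k = y ∧ ∑ k, u k * v k ≤ ∑ k, c k + (y - 1) := by
  have hpos : ∀ k, 0 < min (R k) (c k) := fun k =>
    lt_min (by linarith [hR k]) (by linarith [hc1 k])
  obtain ⟨v, hv, hvy⟩ := exists_prod_eq_of_mem_box (fun k => min_le_left (R k) (c k)) hyc hyR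
  have hhi : x ≤ ∏ k, c k / min (R k) (c k) := by
    rw [Finset.prod_div_distrib, le_div_iff₀ (Finset.prod_pos fun k _ => hpos k), hprod]
    exact mul_le_mul_of_nonneg_left hyc (by linarith)
  have hbox : ∀ k, (1 : ℝ) ≤ c k / min (R k) (c k) := fun k =>
    (one_le_div (hpos k)).2 (min_le_right _ _)
  obtain ⟨u, hu, hux⟩ := exists_prod_eq_of_mem_box (lo := fun _ => 1) hbox (by simpa using hx) hhi
  have hv1 : ∀ k, 1 ≤ v k := fun k => le_trans (le_min (hR k) (hc1 k)) (hv k).1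
  have hu' : ∀ k, u k * min (R k) (c k) ≤ c k := fun k => (le_div_iff₀ (hpos k)).1 (hu k).2
  refine ⟨u, v, fun k => ⟨(hu k).1, ?_⟩, fun k => ⟨hv1 k, (hv k).2⟩, hux, hvy, ?_⟩
  · refine (hu k).2.trans ?_
    rw [div_le_iff₀ (hpos k)]
    rcases min_choice (R k) (c k) with h | h <;> rw [h] <;>
      nlinarith [hR k, hN k, hc1 k, hcm k]
  · have h1 : ∀ k, u k * v k ≤ c k + (v k - 1) := by
      intro k
      have h2 := hu' k
      have h3 := (hv k).1
      rcases le_total (R k) (c k) with h | h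
      · rw [min_eq_left h] at h2 h3
        have : v k = R k := le_antisymm (hv k).2 h3
        rw [this]; linarith [hR k]
      · rw [min_eq_right h] at h2
        have : u k = 1 := le_antisymm (by nlinarith [hc1 k]) (hu k).1
        rw [this]; linarith [hc1 k]
    calc ∑ k, u k * v k ≤ ∑ k, (c k + (v k - 1)) := Finset.sum_le_sum fun k _ => h1 k
      _ ≤ _ := by
        rw [Finset.sum_add_distrib, ← hvy]
        linarith [sum_sub_one_le_prod_sub_one Finset.univ v fun k _ => hv1 k]

end Factorization

/-! ### The two minimization problems behind the lower bound -/

section Optima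

variable {d : ℕ} {n r : Fin d → ℕ} {P : ℕ}

theorem tensorTerm_le_add (hn : ∀ k, 1 ≤ n k) (hr : ∀ k, 1 ≤ r k) (hP : 1 ≤ P) {x y : ℝ}
    (hx : 0 < x) (hy : 0 < y) (hyr : y ≤ ∏ k, (r k : ℝ))
    (hxy : (∏ k, (n k : ℝ)) * (∏ k, (r k : ℝ)) / P ≤ x * y) :
    tensorTerm n r P ≤ x + y := by
  have hR : (0 : ℝ) < ∏ k, (r k : ℝ) :=
    Finset.prod_pos fun k _ => Nat.cast_pos.2 (hr k)
  have hN : (0 : ℝ) < ∏ k, (n k : ℝ) :=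
    Finset.prod_pos fun k _ => Nat.cast_pos.2 (hn k)
  have hP0 : (0 : ℝ) < P := Nat.cast_pos.2 hP
  unfold tensorTerm
  generalize (∏ k, (r k : ℝ)) = R at *
  generalize (∏ k, (n k : ℝ)) = N at *
  split_ifs with h
  · rw [lt_div_iff₀ hR] at h
    have h1 : R ≤ N / P := by rw [le_div_iff₀ hP0]; linarith
    have h2 : N / P * R ≤ x * y := by rwa [div_mul_eq_mul_div]
    -- As y ≤ R ≤ N/P, both factors are nonnegative: on the hyperbola xy = NR/P the sum x + y
    -- decreases until y reaches R.
    have h3 : 0 ≤ (R - y) * (N / P - y) :=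
      mul_nonneg (by linarith) (by linarith)
    have h4 : (N / P + R - y) * y ≤ x * y := by nlinarith
    linarith [le_of_mul_le_mul_right h4 hy]
  · rw [← Real.sqrt_eq_rpow]
    have h1 : Real.sqrt (N * R / P) ≤ (x + y) / 2 := by
      apply Real.sqrt_le_iff.2
      constructor
      · positivity
      · nlinarith [sq_nonneg (x - y)]
    linarith

/-- The alternative x = y or y = r records the two regimes: below y = r the two tensors can exchange
roles. The last clause is the reserve from which the loss y - 1 of the grid is paid. -/
theorem exists_tensorTerm_eq_add (hn : ∀ k, 1 ≤ n k) (hr : ∀ k, 1 ≤ r k)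
    (hnr : ∏ k, r k ≤ ∏ k, n k) (hP : 1 ≤ P) (hPnr : P ≤ (∏ k, n k) * ∏ k, r k) :
    ∃ x y : ℝ, tensorTerm n r P = x + y ∧
      x * y = (∏ k, (n k : ℝ)) * (∏ k, (r k : ℝ)) / P ∧
      1 ≤ x ∧ x ≤ ∏ k, (n k : ℝ) ∧ 1 ≤ y ∧ y ≤ ∏ k, (r k : ℝ) ∧
      (x = y ∨ y = ∏ k, (r k : ℝ)) ∧
      y * (1 - 1 / P) ≤ x + y - (∏ k, (n k : ℝ) + ∏ k, (r k : ℝ)) / P := by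
  have hR : (1 : ℝ) ≤ ∏ k, (r k : ℝ) := by
    exact_mod_cast Nat.succ_le_of_lt (Finset.prod_pos fun k _ => hr k)
  have hN : (1 : ℝ) ≤ ∏ k, (n k : ℝ) := by
    exact_mod_cast Nat.succ_le_of_lt (Finset.prod_pos fun k _ => hn k)
  have hRN : (∏ k, (r k : ℝ)) ≤ ∏ k, (n k : ℝ) := by exact_mod_cast hnr
  have hPN : (P : ℝ) ≤ (∏ k, (n k : ℝ)) * ∏ k, (r k : ℝ) := by exact_mod_cast hPnr
  have hP1 : (1 : ℝ) ≤ P := by exact_mod_cast hP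
  have hP0 : (0 : ℝ) < P := by linarith
  unfold tensorTerm
  generalize (∏ k, (r k : ℝ)) = R at *
  generalize (∏ k, (n k : ℝ)) = N at *
  split_ifs with h
  · rw [lt_div_iff₀ (by linarith)] at h
    have h1 : R ≤ N / P := by rw [le_div_iff₀ hP0]; linarith
    refine ⟨N / P, R, add_comm _ _, by rw [div_mul_eq_mul_div], by linarith,
      div_le_self (by linarith) hP1, hR, le_rfl, Or.inr rfl, le_of_eq ?_⟩
    ring
  · rw [not_lt, div_le_iff₀ (by linarith)] at h
    set w := Real.sqrt (N * R / P) with hw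
    have hw2 : w * w = N * R / P := Real.mul_self_sqrt (by positivity)
    have hw1 : 1 ≤ w := Real.one_le_sqrt.2 (by rwa [one_le_div hP0])
    have hw0 : 0 < w := by linarith
    have hwR : w ≤ R := by
      apply Real.sqrt_le_iff.2
      refine ⟨by linarith, ?_⟩
      rw [div_le_iff₀ hP0]; nlinarith
    have hNP : N / P = w * w / R := by rw [hw2]; field_simp
    have hRP : R / P = w * w / N := by rw [hw2]; field_simp
    have hPi : 1 / (P : ℝ) = w / R * (w / N) := by
      have h1 : 0 < N := by linarith
      have h2 : 0 < R := by linarith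
      rw [div_mul_div_comm, hw2]; field_simp
    refine ⟨w, w, by rw [← Real.sqrt_eq_rpow]; ring, hw2, hw1, hwR.trans hRN, hw1, hwR,
      Or.inl rfl, ?_⟩
    rw [add_div, hNP, hRP, hPi]
    have h1 : w / R ≤ 1 := (div_le_one (by linarith)).2 hwR
    have h2 : w / N ≤ 1 := (div_le_one (by linarith)).2 (hwR.trans hRN)
    -- Because 1/P = (w/R)(w/N), this is the required inequality rearranged.
    have h3 : 0 ≤ w * ((1 - w / R) * (1 - w / N)) :=
      mul_nonneg hw0.le (mul_nonneg (by linarith) (by linarith))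
    rw [mul_div_assoc, mul_div_assoc]
    nlinarith

theorem card_filter_sub_le_val {i : ℕ} (hi : i ≤ d) :
    (Finset.univ.filter fun j : Fin d => d - i ≤ j.val).card = i := by
  have h := Finset.card_filter_add_card_filter_not (s := (Finset.univ : Finset (Fin d)))
    (fun j => j.val < d - i)
  simp only [not_lt, Finset.card_univ, Fintype.card_fin, Fin.card_filter_val_lt] at h
  omega

theorem tailProd_mul_tailProd (i : ℕ) :
    (tailProd n i : ℝ) * tailProd r i = ∏ j : Fin d with d - i ≤ j.val, (n j : ℝ) * r j := by
  simp only [tailProd]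
  push_cast
  rw [Finset.prod_mul_distrib]

theorem tailProd_sub_one (m : Fin d → ℕ) {i : ℕ} (hi : 1 ≤ i) (hid : i ≤ d) :
    tailProd m i = m ⟨d - i, by omega⟩ * tailProd m (i - 1) := by
  unfold tailProd
  rw [← Finset.prod_insert (by simp; omega)]
  congr 1
  ext j
  simp only [Finset.mem_filter, Finset.mem_univ, true_and, Finset.mem_insert, Fin.ext_iff]
  omega

/-- Water filling: c_k = min(n_k r_k, t), with the level t fixed by the product. The first d - I
modes are saturated and the last I stand at t. The condition P < T_I says that the largest saturated
size is below t, and T_{I-1} ≤ P that t does not exceed the smallest remaining size. -/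
theorem exists_matrixTerm_eq_sum (hd : 1 ≤ d) (hn : ∀ k, 1 ≤ n k) (hr : ∀ k, 1 ≤ r k)
    (hmono : Monotone fun k => n k * r k) (hP : 1 ≤ P) (hPnr : P ≤ (∏ k, n k) * ∏ k, r k) :
    ∃ (c : Fin d → ℝ) (t : ℝ), matrixTerm n r P = ∑ k, c k ∧
      ∏ k, c k = (∏ k, (n k : ℝ)) * (∏ k, (r k : ℝ)) / P ∧
      (∀ k, 1 ≤ c k ∧ c k ≤ (n k : ℝ) * r k) ∧ 0 < t ∧
      ∀ k, c k = t ∨ (c k = (n k : ℝ) * r k ∧ c k ≤ t) := by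
  obtain ⟨⟨hI1, hId⟩, hlow, hup⟩ := caseIndex_spec n r P hd
  unfold matrixTerm
  generalize caseIndex n r P = I at *
  have hP0 : (0 : ℝ) < P := Nat.cast_pos.2 hP
  have hm1 : ∀ k, (1 : ℝ) ≤ (n k : ℝ) * r k := fun k => by
    exact_mod_cast Nat.mul_le_mul (hn k) (hr k)
  have hm : ∀ k l, k ≤ l → (n k : ℝ) * r k ≤ (n l : ℝ) * r l := fun k l h => by
    exact_mod_cast hmono h
  have hI0 : I ≠ 0 := by omega
  set Q : ℝ := (tailProd n I : ℝ) * tailProd r I with hQ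
  have hQpos : 0 < Q := by
    rw [hQ, tailProd_mul_tailProd]
    exact Finset.prod_pos fun k _ => by linarith [hm1 k]
  set t : ℝ := (Q / P) ^ (1 / (I : ℝ)) with ht
  have ht0 : 0 < t := Real.rpow_pos_of_pos (by positivity) _
  have htI : t ^ I = Q / P := by
    rw [ht, one_div, Real.rpow_inv_natCast_pow (by positivity) hI0]
  -- the two conditions on the case index
  have hsmall : ∀ j : Fin d, j.val < d - I → (n j : ℝ) * r j ≤ t := by
    intro j hj
    have h1 := hup (by omega)
    have h2 : (n j : ℝ) * r j ≤ _ := hm j (Fin.rev ⟨I, by omega⟩) (by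
      rw [Fin.le_def, Fin.val_rev]; simp only; omega)
    refine h2.trans (le_of_pow_le_pow_left₀ hI0 ht0.le ?_)
    rw [htI, le_div_iff₀ hP0]
    unfold threshold at h1
    rw [lt_div_iff₀ (by have := hm1 (Fin.rev ⟨I, by omega⟩); positivity)] at h1
    simp only at h1
    linarith
  have hlarge : ∀ j : Fin d, ¬ j.val < d - I → t ≤ (n j : ℝ) * r j := by
    intro j hj
    have h2 := hm ⟨d - I, by omega⟩ j (by rw [Fin.le_def]; simp only; omega)
    have h3 := hm1 ⟨d - I, by omega⟩
    refine le_trans (le_of_pow_le_pow_left₀ hI0 (by linarith) ?_) h2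
    rw [htI, div_le_iff₀ hP0, hQ, tailProd_sub_one n hI1 hId, tailProd_sub_one r hI1 hId]
    have h4 : (tailProd n (I - 1) : ℝ) * tailProd r (I - 1) ≤
        P * ((n ⟨d - I, by omega⟩ : ℝ) * r ⟨d - I, by omega⟩) ^ (I - 1) := by
      -- For I = 1 there is no lower threshold; the tail products are empty and the claim is 1 ≤ P.
      rcases Nat.lt_or_ge I 2 with h | h
      · have h5 : I - 1 = 0 := by omega
        rw [h5]
        have h6 : ∀ m : Fin d → ℕ, tailProd m 0 = 1 := fun m => by
          unfold tailProd
          apply Finset.prod_eq_one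
          intro k hk
          have := (Finset.mem_filter.1 hk).2
          omega
        rw [h6, h6]
        simpa using hP
      · have h5 := hlow (by omega) h
        have h6 : Fin.rev ⟨I - 1, by omega⟩ = (⟨d - I, by omega⟩ : Fin d) := by
          ext; simp only [Fin.val_rev]; omega
        unfold threshold at h5
        rw [h6, div_le_iff₀ (by positivity)] at h5
        exact h5
    obtain ⟨J, rfl⟩ : ∃ J, I = J + 1 := ⟨I - 1, by omega⟩
    simp only [Nat.add_sub_cancel] at h4
    simp only [Nat.add_sub_cancel, pow_succ]
    push_cast
    nlinarith
  have hsplit : ∀ f : Fin d → ℝ, (∏ k, if k.val < d - I then (n k : ℝ) * r k else f k) =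
      (∏ k : Fin d with k.val < d - I, (n k : ℝ) * r k) *
        ∏ k : Fin d with d - I ≤ k.val, f k := fun f => by
    rw [Finset.prod_ite]; simp only [not_lt]
  refine ⟨fun k => if k.val < d - I then (n k : ℝ) * r k else t, t, ?_, ?_, fun k => ?_, ht0,
    fun k => ?_⟩
  · rw [Finset.sum_ite, Finset.sum_const]
    simp only [not_lt, card_filter_sub_le_val hId, nsmul_eq_mul]
  · rw [hsplit, Finset.prod_const, card_filter_sub_le_val hId, htI, hQ, tailProd_mul_tailProd,
      ← Finset.prod_mul_distrib, ← mul_div_assoc, ← hsplit]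
    simp only [ite_self]
  · dsimp only
    split_ifs with h
    · exact ⟨hm1 k, le_rfl⟩
    · refine ⟨?_, hlarge k h⟩
      -- If some mode is saturated, t is at least its size; otherwise t ^ d = nr/P, which is at
      -- least 1 as P ≤ nr.
      rcases Nat.lt_or_ge I d with h1 | h1
      · exact (hm1 ⟨0, hd⟩).trans (hsmall ⟨0, hd⟩ (by simp only; omega))
      · refine le_of_pow_le_pow_left₀ hI0 ht0.le ?_
        rw [one_pow, htI, one_le_div hP0, hQ, tailProd_mul_tailProd]
        rw [Finset.filter_true_of_mem fun k _ => by omega, Finset.prod_mul_distrib]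
        exact_mod_cast hPnr
  · dsimp only
    split_ifs with h
    · exact Or.inr ⟨rfl, hsmall k h⟩
    · exact Or.inl rfl

theorem matrixTerm_le_sum (hd : 1 ≤ d) (hn : ∀ k, 1 ≤ n k) (hr : ∀ k, 1 ≤ r k)
    (hmono : Monotone fun k => n k * r k) (hP : 1 ≤ P) (hPnr : P ≤ (∏ k, n k) * ∏ k, r k)
    {a : Fin d → ℝ} (ha : ∀ k, 0 < a k) (ham : ∀ k, a k ≤ (n k : ℝ) * r k)
    (hprod : (∏ k, (n k : ℝ)) * (∏ k, (r k : ℝ)) / P ≤ ∏ k, a k) :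
    matrixTerm n r P ≤ ∑ k, a k := by
  obtain ⟨c, t, hsum, hc, hcm, ht, hct⟩ := exists_matrixTerm_eq_sum hd hn hr hmono hP hPnr
  rw [hsum]
  refine sum_le_sum_of_prod_le_prod ht ha (fun k => by linarith [(hcm k).1]) (fun k => ?_)
    (hc.trans_le hprod)
  exact (hct k).imp_right fun ⟨h1, h2⟩ => ⟨h2, h1 ▸ ham k⟩

/-! ### A grid that is optimal up to a factor of three -/

/-- A collective over P/s processors with a/s words costs a/s - a/P, and the subtracted shares a/P
add up to O. -/
theorem gridCost_eq {p q : Fin d → ℝ} (hp : ∀ k, 0 < p k) (hq : ∀ k, 0 < q k)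
    (hpq : (∏ k, p k) * ∏ k, q k = P) :
    gridCost n r P p q =
      (∏ k, (n k : ℝ)) / ∏ k, p k + (∏ k, (r k : ℝ)) / ∏ k, q k +
        ∑ k, (n k : ℝ) * r k / (p k * q k) - owned n r P := by
  have hp0 : ∏ k, p k ≠ 0 := (Finset.prod_pos fun k _ => hp k).ne'
  have hq0 : ∏ k, q k ≠ 0 := (Finset.prod_pos fun k _ => hq k).ne'
  have hP0 : (P : ℝ) ≠ 0 := hpq ▸ mul_ne_zero hp0 hq0
  have key : ∀ a s : ℝ, s ≠ 0 → collectiveCost (P / s) (a / s) = a / s - a / P := by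
    intro a s hs
    unfold collectiveCost
    field_simp
  have hsum : ∑ k, collectiveCost (P / (p k * q k)) ((n k : ℝ) * r k / (p k * q k)) =
      ∑ k, (n k : ℝ) * r k / (p k * q k) - (∑ k, (n k : ℝ) * r k) / P := by
    rw [Finset.sum_div, ← Finset.sum_sub_distrib]
    exact Finset.sum_congr rfl fun k _ => key _ _ (mul_pos (hp k) (hq k)).ne'
  unfold gridCost owned
  rw [key _ _ hp0, key _ _ hq0, hsum]
  ring

/-- The matrix part of O is covered by A: multiplied by P, the product of the c_j is that of the
sizes n_j r_j, and no c_j exceeds its size, so c_k ≥ n_k r_k / P. Only the tensor part remains. -/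
theorem sub_one_mul_le_lowerBound {c : Fin d → ℝ} {x y : ℝ} (hP : 1 ≤ P)
    (hA : matrixTerm n r P = ∑ k, c k) (hB : tensorTerm n r P = x + y)
    (hc1 : ∀ k, 1 ≤ c k) (hcm : ∀ k, c k ≤ (n k : ℝ) * r k)
    (hprod : ∏ k, c k = (∏ k, (n k : ℝ)) * (∏ k, (r k : ℝ)) / P)
    (hy : y * (1 - 1 / P) ≤ x + y - (∏ k, (n k : ℝ) + ∏ k, (r k : ℝ)) / P) :
    y * (1 - 1 / P) ≤ lowerBound n r P := by
  have hP0 : (0 : ℝ) < P := Nat.cast_pos.2 hP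
  have h1 : ∀ k, (n k : ℝ) * r k / P ≤ c k := by
    intro k
    rw [div_le_iff₀ hP0]
    have h2 : (∏ j, c j) * P = ∏ j, ((n j : ℝ) * r j) := by
      rw [hprod, Finset.prod_mul_distrib, div_mul_cancel₀ _ hP0.ne']
    rw [← Finset.mul_prod_erase _ _ (Finset.mem_univ k),
      ← Finset.mul_prod_erase _ (fun j => (n j : ℝ) * r j) (Finset.mem_univ k)] at h2
    have h3 : ∏ j ∈ Finset.univ.erase k, c j ≤
        ∏ j ∈ Finset.univ.erase k, ((n j : ℝ) * r j) :=
      Finset.prod_le_prod (fun j _ => by linarith [hc1 j]) fun j _ => hcm j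
    have h4 : 0 < ∏ j ∈ Finset.univ.erase k, c j :=
      Finset.prod_pos fun j _ => by linarith [hc1 j]
    have h5 : 0 ≤ (n k : ℝ) * r k := by positivity
    refine le_of_mul_le_mul_right ?_ h4
    nlinarith
  have h2 : (∑ k, (n k : ℝ) * r k) / P ≤ ∑ k, c k := by
    rw [Finset.sum_div]
    exact Finset.sum_le_sum fun k _ => h1 k
  unfold lowerBound owned
  rw [hA, hB, add_div]
  linarith

theorem exists_grid_le_three_mul_lowerBound (hd : 1 ≤ d) (hn : ∀ k, 1 ≤ n k) (hr : ∀ k, 1 ≤ r k)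
    (hmono : Monotone fun k => n k * r k) (hnr : ∏ k, r k ≤ ∏ k, n k)
    (hP : 1 ≤ P) (hPnr : P ≤ (∏ k, n k) * ∏ k, r k) :
    ∃ p q : Fin d → ℝ,
      (∀ k, 1 ≤ p k ∧ p k ≤ n k) ∧ (∀ k, 1 ≤ q k ∧ q k ≤ r k) ∧
      (∏ k, p k) * ∏ k, q k = P ∧ gridCost n r P p q ≤ 3 * lowerBound n r P := by
  obtain ⟨c, t, hA, hc, hcm, -, -⟩ := exists_matrixTerm_eq_sum hd hn hr hmono hP hPnr
  obtain ⟨x, y, hB, hxy, hx1, hxn, hy1, hyr, hor, hy⟩ :=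
    exists_tensorTerm_eq_add hn hr hnr hP hPnr
  have hlb := sub_one_mul_le_lowerBound hP hA hB (fun k => (hcm k).1) (fun k => (hcm k).2) hc hy
  have hn1 : ∀ k, (1 : ℝ) ≤ n k := fun k => by exact_mod_cast hn k
  have hr1 : ∀ k, (1 : ℝ) ≤ r k := fun k => by exact_mod_cast hr k
  rcases hP.eq_or_lt with rfl | hP2
  -- For P = 1 the reserve y(1 - 1/P) vanishes, but the cost is 0 and LB ≥ 0 suffices.
  · refine ⟨fun _ => 1, fun _ => 1, fun k => ⟨le_rfl, hn1 k⟩, fun k => ⟨le_rfl, hr1 k⟩,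
      by simp, ?_⟩
    have h1 : 0 ≤ lowerBound n r 1 := by simpa using hlb
    have h2 : gridCost n r 1 (fun _ => 1) (fun _ => 1) = 0 := by
      simp [gridCost, collectiveCost]
    rw [h2]; positivity
  have hP2' : (2 : ℝ) ≤ P := by exact_mod_cast hP2
  have hP0 : (0 : ℝ) < P := by linarith
  have hhalf : 1 / (P : ℝ) ≤ 1 / 2 := one_div_le_one_div_of_le (by norm_num) hP2'
  have hy2 : y - 1 ≤ 2 * lowerBound n r P := by nlinarith
  have hfac : ∃ u v : Fin d → ℝ, (∀ k, 1 ≤ u k ∧ u k ≤ n k) ∧ (∀ k, 1 ≤ v k ∧ v k ≤ r k) ∧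
      ∏ k, u k = x ∧ ∏ k, v k = y ∧ ∑ k, u k * v k ≤ ∑ k, c k + (y - 1) := by
    by_cases h1 : ∏ k, min (r k : ℝ) (c k) ≤ y
    · exact exists_factorization_le hr1 hn1 (fun k => (hcm k).1) (fun k => (hcm k).2)
        (hc.trans hxy.symm) hx1 h1 hyr
    -- The alternative y = r is excluded, since ∏ min(r_k, c_k) ≤ r.
    have hxy' : x = y := by
      refine hor.resolve_right fun h => h1 ?_
      rw [h]
      exact Finset.prod_le_prod (fun k _ => le_min (by linarith [hr1 k]) (by linarith [(hcm k).1]))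
        fun k _ => min_le_left _ _
    -- With the tensors exchanged the loss is x - 1, which equals y - 1 because x = y.
    by_cases h2 : ∏ k, min (n k : ℝ) (c k) ≤ x
    · obtain ⟨v, u, hv, hu, hvy, hux, hs⟩ := exists_factorization_le (x := y) (y := x) hn1 hr1
        (fun k => (hcm k).1) (fun k => (hcm k).2.trans_eq (mul_comm _ _))
        (by rw [hc, ← hxy, mul_comm]) hy1 h2 hxn
      refine ⟨u, v, hu, hv, hux, hvy, ?_⟩
      rw [← hxy']
      simpa only [mul_comm] using hs
    · obtain ⟨u, v, hu, hv, hux, hvy, hs⟩ := exists_factorization_eq hr1 hn1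
        (fun k => (hcm k).1) (fun k => (hcm k).2) (hc.trans hxy.symm) hx1 (not_le.1 h1).le
        (not_le.1 h2).le
      refine ⟨u, v, hu, hv, hux, hvy, ?_⟩
      rw [Finset.sum_congr rfl fun k _ => hs k]
      linarith
  obtain ⟨u, v, hu, hv, hux, hvy, hs⟩ := hfac
  have hu0 : ∀ k, 0 < u k := fun k => by linarith [(hu k).1]
  have hv0 : ∀ k, 0 < v k := fun k => by linarith [(hv k).1]
  have hn0 : ∀ k, (0 : ℝ) < n k := fun k => by linarith [hn1 k]
  have hr0 : ∀ k, (0 : ℝ) < r k := fun k => by linarith [hr1 k]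
  have hN0 : (0 : ℝ) < ∏ k, (n k : ℝ) := Finset.prod_pos fun k _ => hn0 k
  have hR0 : (0 : ℝ) < ∏ k, (r k : ℝ) := Finset.prod_pos fun k _ => hr0 k
  have hpq : (∏ k, (n k : ℝ) / u k) * ∏ k, (r k : ℝ) / v k = P := by
    rw [Finset.prod_div_distrib, Finset.prod_div_distrib, hux, hvy, div_mul_div_comm, hxy]
    field_simp
  refine ⟨fun k => n k / u k, fun k => r k / v k,
    fun k => ⟨(one_le_div (hu0 k)).2 (hu k).2, div_le_self (hn0 k).le (hu k).1⟩,
    fun k => ⟨(one_le_div (hv0 k)).2 (hv k).2, div_le_self (hr0 k).le (hv k).1⟩, hpq, ?_⟩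
  rw [gridCost_eq (fun k => div_pos (hn0 k) (hu0 k)) (fun k => div_pos (hr0 k) (hv0 k)) hpq]
  have h1 : ∑ k, (n k : ℝ) * r k / (n k / u k * (r k / v k)) = ∑ k, u k * v k := by
    refine Finset.sum_congr rfl fun k _ => ?_
    have := (hn0 k).ne'
    have := (hr0 k).ne'
    have := (hu0 k).ne'
    have := (hv0 k).ne'
    field_simp
  rw [h1, Finset.prod_div_distrib, Finset.prod_div_distrib, hux, hvy, div_div_cancel₀ hN0.ne',
    div_div_cancel₀ hR0.ne']
  have h2 : lowerBound n r P = ∑ k, c k + (x + y) - owned n r P := by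
    rw [lowerBound, hA, hB]
  linarith

end Optima

/-! ### Communication of atomic algorithms -/

section Communication

variable {d : ℕ} {n r : Fin d → ℕ} {P : ℕ}

/-- An entry of the input tensor, of an input matrix, or of the output tensor. -/
abbrev Entry {d : ℕ} (n r : Fin d → ℕ) : Type :=
  Idx n ⊕ (Σ k : Fin d, Fin (n k) × Fin (r k)) ⊕ Idx r

/-- The entry that a word is, or is a partial sum of. -/
def Word.entry : Word n r → Entry n r
  | .x i => .inl i
  | .a k i j => .inr (.inl ⟨k, i, j⟩)
  | .part j _ => .inr (.inr j)

theorem card_entry :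
    Fintype.card (Entry n r) = ∏ k, n k + (∑ k, n k * r k + ∏ k, r k) := by
  simp

namespace Layout

variable (L : Layout n r P)

/-- The processor that owns an entry. -/
def owner : Entry n r → Fin P
  | .inl i => L.ownerX i
  | .inr (.inl e) => L.ownerA e.1 e.2.1 e.2.2
  | .inr (.inr j) => L.ownerY j

/-- The terms computed on processor `s`. -/
def terms (s : Fin P) : Finset (Idx n × Idx r) :=
  Finset.univ.filter fun t => L.proc t.1 t.2 = s

/-- The input tensor entries that occur in the terms computed on processor `s`. -/
def usedX (s : Fin P) : Finset (Idx n) := (L.terms s).image Prod.fst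

/-- The entries of the `k`-th matrix that occur in the terms computed on processor `s`. -/
def usedA (s : Fin P) (k : Fin d) : Finset (Fin (n k) × Fin (r k)) :=
  (L.terms s).image fun t => (t.1 k, t.2 k)

/-- The output tensor entries to which the terms computed on processor `s` contribute. -/
def usedY (s : Fin P) : Finset (Idx r) := (L.terms s).image Prod.snd

/-- All entries involved in the terms computed on processor `s`. -/
def used (s : Fin P) : Finset (Entry n r) :=
  (L.usedX s).disjSum ((Finset.univ.sigma (L.usedA s)).disjSum (L.usedY s))

theorem card_used (s : Fin P) :
    (L.used s).card = (L.usedX s).card + (∑ k, (L.usedA s k).card + (L.usedY s).card) := by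
  simp [used, Finset.card_disjSum, Finset.card_sigma]

theorem card_terms_le_usedX_mul_usedY (s : Fin P) :
    (L.terms s).card ≤ (L.usedX s).card * (L.usedY s).card := by
  rw [← Finset.card_product]
  refine Finset.card_le_card fun t ht => Finset.mem_product.2
    ⟨Finset.mem_image_of_mem _ ht, Finset.mem_image_of_mem _ ht⟩

theorem card_terms_le_prod_usedA (s : Fin P) :
    (L.terms s).card ≤ ∏ k, (L.usedA s k).card := by
  rw [← Fintype.card_piFinset]
  refine Finset.card_le_card_of_injOn (fun t k => (t.1 k, t.2 k)) (fun t ht => ?_) ?_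
  · simp only [Finset.mem_coe, Fintype.mem_piFinset]
    exact fun k => Finset.mem_image.2 ⟨t, ht, rfl⟩
  · intro t _ t' _ h
    refine Prod.ext (funext fun k => ?_) (funext fun k => ?_)
    · exact (Prod.ext_iff.1 (congrFun h k)).1
    · exact (Prod.ext_iff.1 (congrFun h k)).2

variable {L}

/-- The message list `T` contains a message from or to `s` about the entry `e`. -/
def Touches (T : List (Message n r P)) (s : Fin P) (e : Entry n r) : Prop :=
  ∃ m ∈ T, (m.src = s ∨ m.dst = s) ∧ m.word.entry = e

theorem Touches.cons {T : List (Message n r P)} {s : Fin P} {e : Entry n r} (h : Touches T s e)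
    (m : Message n r P) : Touches (m :: T) s e :=
  let ⟨m', hm', h'⟩ := h
  ⟨m', List.mem_cons_of_mem _ hm', h'⟩

/-- Input words are never created in a run, only copied by messages. -/
theorem Run.input_mem {T : List (Message n r P)} {M : Fin P → Set (Word n r)} (h : L.Run T M)
    {s : Fin P} {w : Word n r} (hw : w ∈ M s) (hin : ∀ j S, w ≠ .part j S) :
    L.owner w.entry = s ∨ Touches T s w.entry := by
  induction h generalizing s with
  | start =>
    rcases hw with ⟨i, hi, rfl⟩ | ⟨k, i, j, hi, rfl⟩
    · exact Or.inl hi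
    · exact Or.inl hi
  | compute i j _ _ _ ih =>
    rw [Function.update_apply] at hw
    split_ifs at hw with hs
    · rcases hw with rfl | hw
      · exact absurd rfl (hin _ _)
      · exact ih (hs ▸ hw)
    · exact ih hw
  | add s' j S₁ S₂ _ _ _ _ ih =>
    rw [Function.update_apply] at hw
    split_ifs at hw with hs
    · rcases hw with rfl | hw
      · exact absurd rfl (hin _ _)
      · exact ih (hs ▸ hw)
    · exact ih hw
  | send src dst w' _ _ _ ih =>
    rw [Function.update_apply] at hw
    split_ifs at hw with hs
    · rcases hw with rfl | hw
      · exact Or.inr ⟨_, List.mem_cons_self, Or.inr hs.symm, rfl⟩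
      · exact (ih (hs ▸ hw)).imp id fun h => h.cons _
    · exact (ih hw).imp id fun h => h.cons _

variable (L) in
/-- The term `(i, j)` contributes to a partial sum held by `s`: its processor owns or has received
its factors, and it is `s` or has sent a partial sum of the output entry `j`. -/
def Accounted (T : List (Message n r P)) (s : Fin P) (i : Idx n) (j : Idx r) : Prop :=
  (L.ownerX i = L.proc i j ∨ Touches T (L.proc i j) (.inl i)) ∧
  (∀ k, L.ownerA k (i k) (j k) = L.proc i j ∨
    Touches T (L.proc i j) (.inr (.inl ⟨k, i k, j k⟩))) ∧
  (s = L.proc i j ∨ Touches T (L.proc i j) (.inr (.inr j)))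

theorem Accounted.cons {T : List (Message n r P)} {s : Fin P} {i : Idx n} {j : Idx r}
    (h : L.Accounted T s i j) (m : Message n r P) : L.Accounted (m :: T) s i j :=
  ⟨h.1.imp_right fun h => h.cons m, fun k => (h.2.1 k).imp_right fun h => h.cons m,
    h.2.2.imp_right fun h => h.cons m⟩

/-- Induction along the run. A term enters a partial sum only on its own processor, which then holds
the factors; it reaches another processor only after its own has sent a partial sum of the same
output entry. Additions stay local, and further messages preserve what was recorded. -/
theorem Run.accounted {T : List (Message n r P)} {M : Fin P → Set (Word n r)} (h : L.Run T M)
    {s : Fin P} {j : Idx r} {S : Finset (Idx n)} (hw : Word.part j S ∈ M s) {i : Idx n}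
    (hi : i ∈ S) : L.Accounted T s i j := by
  induction h generalizing s j S with
  | start => rcases hw with ⟨_, _, h⟩ | ⟨_, _, _, _, h⟩ <;> cases h
  | compute i' j' h hx ha ih =>
    rw [Function.update_apply] at hw
    split_ifs at hw with hs
    · rcases hw with hw | hw
      · cases hw
        rw [Finset.mem_singleton] at hi
        subst hi
        exact ⟨h.input_mem hx (by simp), fun k => h.input_mem (ha k) (by simp), Or.inl hs⟩
      · exact ih (hs ▸ hw) hi
    · exact ih hw hi
  | add s' j' S₁ S₂ h h₁ h₂ hS ih =>
    rw [Function.update_apply] at hw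
    split_ifs at hw with hs
    · rcases hw with hw | hw
      · cases hw
        subst hs
        rcases Finset.mem_disjUnion.1 hi with hi | hi
        · exact ih h₁ hi
        · exact ih h₂ hi
      · exact ih (hs ▸ hw) hi
    · exact ih hw hi
  | send src dst w' h hne hw' ih =>
    rw [Function.update_apply] at hw
    split_ifs at hw with hs
    · rcases hw with hw | hw
      · subst hw
        obtain ⟨h1, h2, h3⟩ := (ih hw' hi).cons ⟨src, dst, .part j S⟩
        refine ⟨h1, h2, Or.inr ?_⟩
        -- Either the sender computed the term, and the new message is the required one, or the term
        -- had left its processor before.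
        rcases h3 with h3 | h3
        · exact ⟨_, List.mem_cons_self, Or.inl h3, rfl⟩
        · exact h3
      · exact (ih (hs ▸ hw) hi).cons _
    · exact (ih hw hi).cons _

theorem Computes.owner_eq_or_touches {T : List (Message n r P)} (h : L.Computes T) {s : Fin P}
    {e : Entry n r} (he : e ∈ L.used s) : L.owner e = s ∨ Touches T s e := by
  obtain ⟨M, hrun, hM⟩ := h
  have key : ∀ t ∈ L.terms s, _ := fun t ht => by
    have h1 := hrun.accounted (hM t.2) (Finset.mem_univ t.1)
    rw [Accounted, (Finset.mem_filter.1 ht).2] at h1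
    exact h1
  rcases e with i | ⟨k, a⟩ | j
  · simp only [used, Finset.inl_mem_disjSum, usedX, Finset.mem_image] at he
    obtain ⟨t, ht, rfl⟩ := he
    exact (key t ht).1
  · simp only [used, Finset.inr_mem_disjSum, Finset.inl_mem_disjSum, Finset.mem_sigma, usedA,
      Finset.mem_image, Finset.mem_univ, true_and] at he
    obtain ⟨t, ht, rfl⟩ := he
    exact (key t ht).2.1 k
  · simp only [used, Finset.inr_mem_disjSum, usedY, Finset.mem_image] at he
    obtain ⟨t, ht, rfl⟩ := he
    exact (key t ht).2.2

/-- A message concerns a single entry, so the number of entries touched is at most the traffic. -/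
theorem Computes.card_used_le {T : List (Message n r P)} (h : L.Computes T) (s : Fin P) :
    (L.used s).card ≤ (Finset.univ.filter fun e => L.owner e = s).card + traffic T s := by
  have h1 : L.used s ⊆ (Finset.univ.filter fun e => L.owner e = s) ∪
      ((T.filter fun m => decide (m.src = s ∨ m.dst = s)).map fun m => m.word.entry).toFinset := by
    intro e he
    rw [Finset.mem_union]
    rcases h.owner_eq_or_touches he with h2 | ⟨m, hm, hs, rfl⟩
    · exact Or.inl (by simpa using h2)
    · refine Or.inr (List.mem_toFinset.2 (List.mem_map.2 ⟨m, ?_, rfl⟩))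
      simpa using ⟨hm, hs⟩
  refine (Finset.card_le_card h1).trans ((Finset.card_union_le _ _).trans ?_)
  refine Nat.add_le_add_left ((List.toFinset_card_le _).trans ?_) _
  rw [List.length_map, traffic, List.countP_eq_length_filter]

variable (L) in
theorem exists_card_owned_mul_le (hP : 1 ≤ P) :
    ∃ s, (Finset.univ.filter fun e => L.owner e = s).card * P ≤ Fintype.card (Entry n r) := by
  by_contra! hcon
  have h1 : ∑ s, (Finset.univ.filter fun e => L.owner e = s).card = Fintype.card (Entry n r) :=
    (Finset.card_eq_sum_card_fiberwise fun e _ => Finset.mem_univ (L.owner e)).symm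
  have h2 : ∑ _s : Fin P, Fintype.card (Entry n r) <
      ∑ s, (Finset.univ.filter fun e => L.owner e = s).card * P :=
    Finset.sum_lt_sum_of_nonempty ⟨⟨0, hP⟩, Finset.mem_univ _⟩ fun s _ => hcon s
  rw [← Finset.sum_mul, h1] at h2
  simp [mul_comm] at h2

end Layout

end Communication

/-! ### The grid algorithm -/

section GridAlgorithm

theorem card_block {m b : ℕ} (h : b ∣ m) (c : Fin b) : (block m b c).card = m / b := by
  have h1 : (c.val + 1) * (m / b) ≤ m := by
    calc (c.val + 1) * (m / b) ≤ b * (m / b) := Nat.mul_le_mul_right _ c.isLt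
      _ = m := Nat.mul_div_cancel' h
  have h2 : (block m b c).map Fin.valEmbedding =
      Finset.Ico (c.val * (m / b)) ((c.val + 1) * (m / b)) := by
    ext a
    simp only [block, Finset.mem_map, Finset.mem_filter, Finset.mem_univ, true_and,
      Fin.valEmbedding_apply, Finset.mem_Ico]
    constructor
    · rintro ⟨i, hi, rfl⟩
      exact hi
    · exact fun ha => ⟨⟨a, ha.2.trans_le h1⟩, ha, rfl⟩
  rw [← Finset.card_map Fin.valEmbedding, h2, Nat.card_Ico, add_mul, one_mul,
    Nat.add_sub_cancel_left]

theorem existsUnique_mem_block {m b : ℕ} (h : b ∣ m) (i : Fin m) :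
    ∃! c : Fin b, i ∈ block m b c := by
  have hm : 0 < m := i.pos
  have hq : 0 < m / b := Nat.div_pos (Nat.le_of_dvd hm h) (Nat.pos_of_dvd_of_pos h hm)
  have hlt : i.val / (m / b) < b := by
    rw [Nat.div_lt_iff_lt_mul hq, Nat.mul_div_cancel' h]
    exact i.isLt
  have key : ∀ c : Fin b, i ∈ block m b c ↔ i.val / (m / b) = c.val := by
    intro c
    rw [Nat.div_eq_iff hq]
    simp only [block, Finset.mem_filter, Finset.mem_univ, true_and, add_mul, one_mul]
    omega
  exact ⟨⟨_, hlt⟩, (key _).2 rfl, fun c hc => Fin.ext ((key c).1 hc).symm⟩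

variable {d : ℕ} {n r p q : Fin d → ℕ}

theorem existsUnique_mem_piFinset_block (hp : ∀ k, p k ∣ n k) (i : Idx n) :
    ∃! s : Idx p, i ∈ Fintype.piFinset fun k => block (n k) (p k) (s k) := by
  choose c hc hu using fun k => existsUnique_mem_block (hp k) (i k)
  refine ⟨c, Fintype.mem_piFinset.2 hc, fun s hs => funext fun k => hu k _ ?_⟩
  exact Fintype.mem_piFinset.1 hs k

theorem card_blockX (hp : ∀ k, p k ∣ n k) (s : GridProc p q) :
    (blockX n s).card = ∏ k, n k / p k := by
  rw [blockX, Fintype.card_piFinset]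
  exact Finset.prod_congr rfl fun k _ => card_block (hp k) _

theorem card_blockY (hq : ∀ k, q k ∣ r k) (s : GridProc p q) :
    (blockY r s).card = ∏ k, r k / q k := by
  rw [blockY, Fintype.card_piFinset]
  exact Finset.prod_congr rfl fun k _ => card_block (hq k) _

theorem card_blockA (hp : ∀ k, p k ∣ n k) (hq : ∀ k, q k ∣ r k) (k : Fin d) (s : GridProc p q) :
    (blockA n r k s).card = n k / p k * (r k / q k) := by
  rw [blockA, Finset.card_product, card_block (hp k), card_block (hq k)]

theorem card_groupX (s : GridProc p q) : (groupX s).card = ∏ k, q k := by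
  have : groupX s = {s.1} ×ˢ Finset.univ := by
    ext t; simp only [groupX, Finset.mem_filter, Finset.mem_product, Finset.mem_singleton,
      Finset.mem_univ, true_and, and_true]
  rw [this, Finset.card_product]
  simp

theorem card_groupY (s : GridProc p q) : (groupY s).card = ∏ k, p k := by
  have : groupY s = Finset.univ ×ˢ {s.2} := by
    ext t; simp only [groupY, Finset.mem_filter, Finset.mem_product, Finset.mem_singleton,
      Finset.mem_univ, true_and]
  rw [this, Finset.card_product]
  simp

theorem card_filter_apply_eq (k : Fin d) (c : Fin (p k)) :
    (Finset.univ.filter fun t : Idx p => t k = c).card * p k = ∏ j, p j := by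
  have h : (Finset.univ.filter fun t : Idx p => t k = c) =
      Fintype.piFinset (Function.update (fun j => (Finset.univ : Finset (Fin (p j)))) k {c}) := by
    ext t
    simp only [Finset.mem_filter, Finset.mem_univ, true_and, Fintype.mem_piFinset]
    constructor
    · rintro rfl j
      rcases eq_or_ne j k with rfl | hj
      · simp
      · simp [hj]
    · intro ht
      simpa using ht k
  rw [h, Fintype.card_piFinset, ← Finset.mul_prod_erase _ _ (Finset.mem_univ k),
    ← Finset.mul_prod_erase _ p (Finset.mem_univ k), mul_comm (p k)]
  congr 1
  rw [Function.update_self, Finset.card_singleton, one_mul]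
  refine Finset.prod_congr rfl fun j hj => ?_
  rw [Function.update_of_ne (Finset.ne_of_mem_erase hj), Finset.card_univ, Fintype.card_fin]

theorem card_groupA (k : Fin d) (s : GridProc p q) :
    (groupA k s).card * (p k * q k) = (∏ j, p j) * ∏ j, q j := by
  have : groupA k s = (Finset.univ.filter fun t : Idx p => t k = s.1 k) ×ˢ
      (Finset.univ.filter fun t : Idx q => t k = s.2 k) := by
    ext t; simp [groupA]
  rw [this, Finset.card_product, ← card_filter_apply_eq k (s.1 k), ← card_filter_apply_eq k (s.2 k)]
  ring

theorem existsUnique_gridProc (hp : ∀ k, p k ∣ n k) (hq : ∀ k, q k ∣ r k) (i : Idx n) (j : Idx r) :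
    ∃! s : GridProc p q, i ∈ blockX n s ∧ j ∈ blockY r s := by
  obtain ⟨a, ha, hau⟩ := existsUnique_mem_piFinset_block hp i
  obtain ⟨b, hb, hbu⟩ := existsUnique_mem_piFinset_block hq j
  exact ⟨(a, b), ⟨ha, hb⟩, fun s hs => Prod.ext (hau _ hs.1) (hbu _ hs.2)⟩

theorem card_blockX_mul_card_blockY (hp : ∀ k, p k ∣ n k) (hq : ∀ k, q k ∣ r k)
    (s : GridProc p q) :
    (blockX n s).card * (blockY r s).card * ((∏ k, p k) * ∏ k, q k) =
      (∏ k, n k) * ∏ k, r k := by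
  rw [card_blockX hp, card_blockY hq, mul_mul_mul_comm, ← Finset.prod_mul_distrib,
    ← Finset.prod_mul_distrib]
  congr 1
  · exact Finset.prod_congr rfl fun k _ => Nat.div_mul_cancel (hp k)
  · exact Finset.prod_congr rfl fun k _ => Nat.div_mul_cancel (hq k)

/-- The input blocks of the processors in one Reduce-Scatter group partition all input indices, so
each term is summed once. -/
theorem gridAlgorithmOutput_eq_multiTTM (hp : ∀ k, p k ∣ n k) (X : Idx n → ℝ)
    (A : ∀ k : Fin d, Matrix (Fin (n k)) (Fin (r k)) ℝ) (s : GridProc p q) (j : Idx r) :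
    gridAlgorithmOutput X A s j = multiTTM X A j := by
  have h : groupY s = Finset.univ.map ⟨fun a : Idx p => (a, s.2), Prod.mk_left_injective s.2⟩ := by
    ext t
    simp only [groupY, Finset.mem_filter, Finset.mem_univ, true_and, Finset.mem_map,
      Function.Embedding.coeFn_mk]
    exact ⟨fun ht => ⟨t.1, Prod.ext rfl ht.symm⟩, fun ⟨a, ha⟩ => ha ▸ rfl⟩
  unfold gridAlgorithmOutput localMultiTTM multiTTM
  rw [h, Finset.sum_map, ← Finset.sum_biUnion]
  · refine Finset.sum_congr (Finset.eq_univ_of_forall fun i => ?_) fun _ _ => rfl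
    obtain ⟨a, ha, -⟩ := existsUnique_mem_piFinset_block hp i
    exact Finset.mem_biUnion.2 ⟨a, Finset.mem_univ _, ha⟩
  · intro a _ b _ hab
    refine Finset.disjoint_left.2 fun i ha hb => hab ?_
    exact (existsUnique_mem_piFinset_block hp i).unique ha hb

theorem lineCost_eq_of_forall [Nonempty (GridProc p q)]
    {group : GridProc p q → Finset (GridProc p q)} {words : GridProc p q → ℕ} {Q w : ℝ}
    (hg : ∀ s, ((group s).card : ℝ) = Q) (hw : ∀ s, (words s : ℝ) = w) :
    lineCost group words = collectiveCost Q w := by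
  unfold lineCost
  simp only [hg, hw, ciSup_const]

theorem gridAlgorithmCost_eq_gridCost (hn : ∀ k, 1 ≤ n k) (hr : ∀ k, 1 ≤ r k)
    (hp : ∀ k, p k ∣ n k) (hq : ∀ k, q k ∣ r k) :
    gridAlgorithmCost n r p q =
      gridCost n r ((∏ k, p k) * ∏ k, q k) (fun k => p k) (fun k => q k) := by
  have hp0 : ∀ k, 0 < p k := fun k => Nat.pos_of_dvd_of_pos (hp k) (hn k)
  have hq0 : ∀ k, 0 < q k := fun k => Nat.pos_of_dvd_of_pos (hq k) (hr k)
  have hpr : (∏ k, (p k : ℝ)) ≠ 0 :=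
    Finset.prod_ne_zero_iff.2 fun k _ => Nat.cast_ne_zero.2 (hp0 k).ne'
  have hqr : (∏ k, (q k : ℝ)) ≠ 0 :=
    Finset.prod_ne_zero_iff.2 fun k _ => Nat.cast_ne_zero.2 (hq0 k).ne'
  -- On an empty grid the supremum in `lineCost` would take the default value 0.
  have : Nonempty (GridProc p q) := ⟨(fun k => ⟨0, hp0 k⟩, fun k => ⟨0, hq0 k⟩)⟩
  have hdiv : ∀ {a b : ℕ}, b ∣ a → ((a / b : ℕ) : ℝ) = a / b := fun h =>
    Nat.cast_div_charZero h
  unfold gridAlgorithmCost gridCost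
  push_cast
  congr 1
  congr 1
  · apply lineCost_eq_of_forall
    · intro s
      rw [card_groupX, mul_div_cancel_left₀ _ hpr]
      push_cast; rfl
    · intro s
      rw [card_blockX hp, ← Finset.prod_div_distrib]
      push_cast
      exact Finset.prod_congr rfl fun k _ => hdiv (hp k)
  · refine Finset.sum_congr rfl fun k _ => lineCost_eq_of_forall (fun s => ?_) fun s => ?_
    · rw [eq_div_iff (mul_ne_zero (Nat.cast_ne_zero.2 (hp0 k).ne')
        (Nat.cast_ne_zero.2 (hq0 k).ne'))]
      exact_mod_cast card_groupA k s
    · rw [card_blockA hp hq, Nat.cast_mul, hdiv (hp k), hdiv (hq k), div_mul_div_comm]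
  · apply lineCost_eq_of_forall
    · intro s
      rw [card_groupY, mul_div_cancel_right₀ _ hqr]
      push_cast; rfl
    · intro s
      rw [card_blockY hq, ← Finset.prod_div_distrib]
      push_cast
      exact Finset.prod_congr rfl fun k _ => hdiv (hq k)

end GridAlgorithm

/-! ### The communication lower bound -/

theorem Layout.exists_lowerBound_le_traffic {d : ℕ} (hd : 1 ≤ d) {n r : Fin d → ℕ}
    (hn : ∀ k, 1 ≤ n k) (hr : ∀ k, 1 ≤ r k) (hmono : Monotone fun k => n k * r k)
    {P : ℕ} (hP : 1 ≤ P) (hPnr : P ≤ (∏ k, n k) * ∏ k, r k) {L : Layout n r P}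
    {T : List (Message n r P)} (hL : L.LoadBalanced) (hT : L.Computes T) :
    ∃ s : Fin P, lowerBound n r P ≤ traffic T s := by
  obtain ⟨s, hs⟩ := L.exists_card_owned_mul_le hP
  refine ⟨s, ?_⟩
  have hP0 : (0 : ℝ) < P := Nat.cast_pos.2 hP
  have hF : ((L.terms s).card : ℝ) * P = (∏ k, (n k : ℝ)) * ∏ k, (r k : ℝ) := by
    exact_mod_cast hL s
  have hF' : (∏ k, (n k : ℝ)) * (∏ k, (r k : ℝ)) / P = (L.terms s).card := by
    rw [← hF, mul_div_cancel_right₀ _ hP0.ne']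
  -- Load balance and 1 ≤ P ≤ nr give a positive load; both minimization bounds require positive
  -- variables.
  have hne : (L.terms s).Nonempty := by
    rw [← Finset.card_pos]
    refine Nat.pos_of_ne_zero fun h => ?_
    have := hL s
    change (L.terms s).card * P = _ at this
    rw [h, zero_mul] at this
    omega
  have hB : tensorTerm n r P ≤ (L.usedX s).card + (L.usedY s).card := by
    refine tensorTerm_le_add hn hr hP ?_ ?_ ?_ ?_
    · exact_mod_cast Finset.card_pos.2 (hne.image _)
    · exact_mod_cast Finset.card_pos.2 (hne.image _)
    · have h := Finset.card_le_univ (L.usedY s)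
      rw [Fintype.card_pi] at h
      simp only [Fintype.card_fin] at h
      exact_mod_cast h
    · rw [hF']
      exact_mod_cast L.card_terms_le_usedX_mul_usedY s
  have hA : matrixTerm n r P ≤ ∑ k, ((L.usedA s k).card : ℝ) := by
    refine matrixTerm_le_sum hd hn hr hmono hP hPnr (fun k => ?_) (fun k => ?_) ?_
    · exact_mod_cast Finset.card_pos.2 (hne.image _)
    · have h := Finset.card_le_univ (L.usedA s k)
      rw [Fintype.card_prod, Fintype.card_fin, Fintype.card_fin] at h
      exact_mod_cast h
    · rw [hF']
      exact_mod_cast L.card_terms_le_prod_usedA s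
  have hO : ((Finset.univ.filter fun e => L.owner e = s).card : ℝ) ≤ owned n r P := by
    rw [owned, le_div_iff₀ hP0]
    rw [card_entry] at hs
    have h : ((Finset.univ.filter fun e => L.owner e = s).card : ℝ) * P ≤
        ∏ k, (n k : ℝ) + (∑ k, (n k : ℝ) * r k + ∏ k, (r k : ℝ)) := by exact_mod_cast hs
    linarith
  have hU := hT.card_used_le s
  rw [L.card_used] at hU
  have hU' : ((L.usedX s).card : ℝ) + (∑ k, ((L.usedA s k).card : ℝ) + (L.usedY s).card) ≤
      (Finset.univ.filter fun e => L.owner e = s).card + traffic T s := by exact_mod_cast hU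
  unfold lowerBound
  linarith

end MultiTTM

open MultiTTM in
theorem theorem7p1 {d : ℕ} (hd : 1 ≤ d) (n r : Fin d → ℕ)
    (hn : ∀ k, 2 ≤ n k) (hr : ∀ k, 2 ≤ r k)
    (hmono : Monotone fun k => n k * r k)
    (hnr : ∏ k, r k ≤ ∏ k, n k)
    (P : ℕ) (hP : 1 ≤ P) (hPnr : P ≤ (∏ k, n k) * ∏ k, r k) :
    -- `lowerBound` bounds the communication of every load balanced atomic algorithm
    (∀ (L : Layout n r P) (T : List (Message n r P)), L.LoadBalanced → L.Computes T →
      ∃ s : Fin P, lowerBound n r P ≤ traffic T s) ∧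
    -- on every integral grid the algorithm is atomic, load balanced and correct, and has cost
    -- `gridCost`
    (∀ p q : Fin d → ℕ, (∀ k, p k ∣ n k) → (∀ k, q k ∣ r k) → (∏ k, p k) * ∏ k, q k = P →
      (∀ (i : Idx n) (j : Idx r), ∃! s : GridProc p q, i ∈ blockX n s ∧ j ∈ blockY r s) ∧
      (∀ s : GridProc p q,
        (blockX n s).card * (blockY r s).card * P = (∏ k, n k) * ∏ k, r k) ∧
      (∀ (X : Idx n → ℝ) (A : ∀ k : Fin d, Matrix (Fin (n k)) (Fin (r k)) ℝ)
        (s : GridProc p q), ∀ j ∈ blockY r s,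
          gridAlgorithmOutput X A s j = multiTTM X A j) ∧
      gridAlgorithmCost n r p q = gridCost n r P (fun k => p k) (fun k => q k)) ∧
    -- some grid is optimal up to a factor of three
    ∃ p q : Fin d → ℝ,
      (∀ k, 1 ≤ p k ∧ p k ≤ n k) ∧ (∀ k, 1 ≤ q k ∧ q k ≤ r k) ∧
      (∏ k, p k) * ∏ k, q k = P ∧
      gridCost n r P p q =
        (∏ k, (n k : ℝ)) / ∏ k, p k + (∏ k, (r k : ℝ)) / ∏ k, q k +
          ∑ k, (n k : ℝ) * r k / (p k * q k) - owned n r P ∧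
      gridCost n r P p q ≤ 3 * lowerBound n r P := by
  have hn1 : ∀ k, 1 ≤ n k := fun k => one_le_two.trans (hn k)
  have hr1 : ∀ k, 1 ≤ r k := fun k => one_le_two.trans (hr k)
  refine ⟨fun L T hL hT => Layout.exists_lowerBound_le_traffic hd hn1 hr1 hmono hP hPnr hL hT,
    fun p q hp hq hpq => ?_, ?_⟩
  · subst hpq
    exact ⟨existsUnique_gridProc hp hq, card_blockX_mul_card_blockY hp hq,
      fun X A s j _ => gridAlgorithmOutput_eq_multiTTM hp X A s j,
      gridAlgorithmCost_eq_gridCost hn1 hr1 hp hq⟩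
  · obtain ⟨p, q, hp, hq, hpq, hle⟩ :=
      exists_grid_le_three_mul_lowerBound hd hn1 hr1 hmono hnr hP hPnr
    exact ⟨p, q, hp, hq, hpq, gridCost_eq (fun k => one_pos.trans_le (hp k).1)
      (fun k => one_pos.trans_le (hq k).1) hpq, hle⟩
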